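/- There are universal constants $K_1,K_2>0$ such that the following holds for every $d\in\mathbb{N}$ and every $\rho\in(0,1)$. Let $R\in\mathbb{R}^{d\times d}$ be a symmetric random matrix with zero diagonal and mean-zero entries bounded by $1$ in absolute value; the entries of $R$ need be neither independent nor identically distributed. Let $B\in\{0,1\}^{d\times d}$ be a symmetric random matrix whose entries $b_{i,j}=b_{j,i}$, $j<i$, are iid Bernoulli($\rho$), and let $A=R\circ B$ be the entrywise (Hadamard) product, $a_{i,j}=r_{i,j}b_{i,j}$. Let $\mathcal{E}\in\{-1,1\}^{d\times d}$ be a symmetric random matrix, independent of $A$, whose entries $\varepsilon_{i,j}=\varepsilon_{j,i}$, $j<i$, are iid Rademacher (each of $\pm1$ with probability $1/2$). Then $$ \mathbb{E}\,\|A\circ\mathcal{E}\|_\infty\;\le\;K_1\,d^{1/2}\rho^{1/4}+K_2\,d^{3/4}\rho^{1/2}, $$ where $\|M\|_\infty=\sup_{\|u\|_{\ell^2}=1}\|Mu\|_{\ell^2}$ denotes the operator norm with respect to the Euclidean norm (the Schatten norm with $p=\infty$). -/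

import Mathlib

open MeasureTheory ProbabilityTheory
open scoped Matrix

/-- The Schatten norm with `p = ∞` of a real square matrix: the operator norm
with respect to the Euclidean norm. -/
noncomputable def schattenInfNorm {d : ℕ} (M : Matrix (Fin d) (Fin d) ℝ) : ℝ :=
  ‖Matrix.toEuclideanCLM (n := Fin d) (𝕜 := ℝ) M‖

/-- `R` is a symmetric random matrix with zero diagonal and mean zero entries bounded by `1`.
Nothing is assumed about the joint law of its entries. -/
structure IsBoundedCenteredSymm {d : ℕ} {Ω : Type*} [MeasurableSpace Ω] (P : Measure Ω)
    (R : Ω → Matrix (Fin d) (Fin d) ℝ) : Prop where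
  measurable : ∀ i j, Measurable fun ω => R ω i j
  symm : ∀ᵐ ω ∂P, (R ω).IsSymm
  diag_zero : ∀ᵐ ω ∂P, ∀ i, R ω i i = 0
  mean_zero : ∀ i j, ∫ ω, R ω i j ∂P = 0
  bounded : ∀ᵐ ω ∂P, ∀ i j, |R ω i j| ≤ 1

/-- `B` is a symmetric `{0,1}`-valued random matrix whose entries below the diagonal are iid
Bernoulli with parameter `ρ`. The diagonal entries are arbitrary `{0,1}`-valued random
variables; this includes the case where they too are Bernoulli and independent of the others. -/
structure IsSymmBernoulli {d : ℕ} {Ω : Type*} [MeasurableSpace Ω] (P : Measure Ω) (ρ : ℝ)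
    (B : Ω → Matrix (Fin d) (Fin d) ℝ) : Prop where
  measurable : ∀ i j, Measurable fun ω => B ω i j
  symm : ∀ᵐ ω ∂P, (B ω).IsSymm
  values : ∀ᵐ ω ∂P, ∀ i j, B ω i j = 0 ∨ B ω i j = 1
  law : ∀ i j, j < i → P {ω | B ω i j = 1} = ENNReal.ofReal ρ
  indep : iIndepFun (fun (p : {p : Fin d × Fin d // p.2 < p.1}) ω => B ω p.1.1 p.1.2) P

/-- `E` is a symmetric `{-1,1}`-valued random matrix whose entries below the diagonal are iid
Rademacher. -/
structure IsSymmRademacher {d : ℕ} {Ω : Type*} [MeasurableSpace Ω] (P : Measure Ω)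
    (E : Ω → Matrix (Fin d) (Fin d) ℝ) : Prop where
  measurable : ∀ i j, Measurable fun ω => E ω i j
  symm : ∀ᵐ ω ∂P, (E ω).IsSymm
  values : ∀ᵐ ω ∂P, ∀ i j, E ω i j = -1 ∨ E ω i j = 1
  law : ∀ i j, j < i → P {ω | E ω i j = 1} = 1 / 2
  indep : iIndepFun (fun (p : {p : Fin d × Fin d // p.2 < p.1}) ω => E ω p.1.1 p.1.2) P

/-!
The proof is a fourth moment computation. For `X = (R ⊙ B) ⊙ E`, the C⋆-identity and the comparison
of the operator norm with the Frobenius norm give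
`‖X‖ ^ 4 = ‖X * Xᵀ‖ ^ 2 ≤ ∑ i k j l, X i j * X k j * X i l * X k l`
(`schattenInfNorm_pow_four_le`). Each summand is a closed walk of length four in the complete graph.
Walks with a loop vanish because the diagonal of `R` does. If `i ≠ k` and `j ≠ l`, the four edges
are distinct, so the Rademacher factor, which is independent of `R ⊙ B`, makes the expectation zero.
Otherwise the summand is a product of two squares, dominated by the product of the corresponding
entries of `B`: its expectation is at most `ρ ^ 2`, or `ρ` if both edges coincide
(`integral_walk_le`).

Counting walks gives `𝔼 ‖X‖ ^ 4 ≤ d ^ 2 * ρ + 2 * d ^ 3 * ρ ^ 2`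
(`integral_schattenInfNorm_pow_four_le`). Jensen's inequality and the subadditivity of the fourth
root yield the bound on `𝔼 ‖X‖` with constants `1` and `2`.
-/

/-! ### The operator norm and the Frobenius norm -/

lemma schattenInfNorm_nonneg {d : ℕ} (M : Matrix (Fin d) (Fin d) ℝ) : 0 ≤ schattenInfNorm M :=
  norm_nonneg _

/-- The operator norm is at most the Frobenius (Hilbert–Schmidt) norm. -/
lemma sq_schattenInfNorm_le_sum_sq {d : ℕ} (M : Matrix (Fin d) (Fin d) ℝ) :
    schattenInfNorm M ^ 2 ≤ ∑ i, ∑ k, M i k ^ 2 := by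
  have hS : 0 ≤ ∑ i, ∑ k, M i k ^ 2 := by positivity
  rw [← Real.le_sqrt (schattenInfNorm_nonneg M) hS]
  refine ContinuousLinearMap.opNorm_le_bound _ (Real.sqrt_nonneg _) fun x => ?_
  rw [EuclideanSpace.norm_eq, EuclideanSpace.norm_eq, ← Real.sqrt_mul hS]
  refine Real.sqrt_le_sqrt ?_
  rw [Finset.sum_mul]
  refine Finset.sum_le_sum fun i _ => ?_
  have h := Finset.sum_mul_sq_le_sq_mul_sq Finset.univ (M i) (fun k => x k)
  simpa [Matrix.mulVec, dotProduct] using h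

/-- By the C⋆-identity, the square of the operator norm of `M` is the operator norm of `M * Mᵀ`. -/
lemma schattenInfNorm_mul_transpose {d : ℕ} (M : Matrix (Fin d) (Fin d) ℝ) :
    schattenInfNorm (M * M.transpose) = schattenInfNorm M ^ 2 := by
  have h : M.transpose = star M := by
    rw [Matrix.star_eq_conjTranspose, Matrix.conjTranspose_eq_transpose_of_trivial]
  rw [schattenInfNorm, h, map_mul, map_star, schattenInfNorm, sq]
  exact CStarRing.norm_self_mul_star

lemma schattenInfNorm_pow_four_le {d : ℕ} (M : Matrix (Fin d) (Fin d) ℝ) :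
    schattenInfNorm M ^ 4 ≤ ∑ i, ∑ k, ∑ j, ∑ l, (M i j * M k j) * (M i l * M k l) := by
  have h := sq_schattenInfNorm_le_sum_sq (M * M.transpose)
  rw [schattenInfNorm_mul_transpose, ← pow_mul] at h
  refine h.trans_eq (Finset.sum_congr rfl fun i _ => Finset.sum_congr rfl fun k _ => ?_)
  simp only [Matrix.mul_apply, Matrix.transpose_apply, sq, Finset.sum_mul_sum]

lemma continuous_schattenInfNorm {d : ℕ} :
    Continuous (schattenInfNorm : Matrix (Fin d) (Fin d) ℝ → ℝ) :=
  continuous_norm.comp (LinearMap.continuous_of_finiteDimensional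
    (Matrix.toEuclideanCLM (n := Fin d) (𝕜 := ℝ)).toAlgEquiv.toLinearMap)

lemma measurable_schattenInfNorm {d : ℕ} {Ω : Type*} [MeasurableSpace Ω]
    {X : Ω → Matrix (Fin d) (Fin d) ℝ} (hX : ∀ i j, Measurable fun ω => X ω i j) :
    Measurable fun ω => schattenInfNorm (X ω) := by
  have hc : Continuous fun a : Fin d → Fin d → ℝ => schattenInfNorm (Matrix.of a) :=
    continuous_schattenInfNorm
  have h := hc.measurable
  exact h.comp (measurable_pi_lambda _ fun i => measurable_pi_lambda _ fun j => hX i j)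

/-! ### Independent entries of symmetric random matrices -/

/-- If the entries below the diagonal of a symmetric random matrix are independent, then the
expectation factorizes over any finite family of off-diagonal positions that are distinct as
unordered pairs. -/
lemma integral_prod_entries {d : ℕ} {Ω : Type*} [MeasurableSpace Ω] {P : Measure Ω}
    {M : Ω → Matrix (Fin d) (Fin d) ℝ} (hmeas : ∀ i j, Measurable fun ω => M ω i j)
    (hsymm : ∀ᵐ ω ∂P, (M ω).IsSymm)
    (hind : iIndepFun (fun (p : {p : Fin d × Fin d // p.2 < p.1}) ω => M ω p.1.1 p.1.2) P)
    {n : ℕ} (u v : Fin n → Fin d) (huv : ∀ t, u t ≠ v t)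
    (hinj : ∀ s t, s ≠ t → s(u s, v s) ≠ s(u t, v t)) :
    ∫ ω, ∏ t, M ω (u t) (v t) ∂P = ∏ t, ∫ ω, M ω (u t) (v t) ∂P := by
  let e : Fin n → {p : Fin d × Fin d // p.2 < p.1} := fun t =>
    ⟨(max (u t) (v t), min (u t) (v t)), min_lt_max.2 (huv t)⟩
  have he : Function.Injective e := by
    intro s t hst
    by_contra hne
    have h1 : max (u s) (v s) = max (u t) (v t) := congrArg (fun p => p.1.1) hst
    have h2 : min (u s) (v s) = min (u t) (v t) := congrArg (fun p => p.1.2) hst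
    have h3 := hinj s t hne
    simp only [ne_eq, Sym2.eq_iff] at h3
    grind
  have h := hind.precomp he
  have hcongr : iIndepFun (fun t ω => M ω (u t) (v t)) P := by
    refine h.congr fun t => ?_
    filter_upwards [hsymm] with ω hω
    rcases le_total (u t) (v t) with h' | h'
    · simp [e, h', hω.apply]
    · simp [e, h']
  exact hcongr.integral_fun_prod_eq_prod_integral fun t => (hmeas _ _).aestronglyMeasurable

/-- The law below the diagonal transfers to all off-diagonal entries by symmetry. -/
lemma measure_entry_eq_one {d : ℕ} {Ω : Type*} [MeasurableSpace Ω] {P : Measure Ω}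
    {M : Ω → Matrix (Fin d) (Fin d) ℝ} (hsymm : ∀ᵐ ω ∂P, (M ω).IsSymm) {c : ENNReal}
    (hlaw : ∀ i j, j < i → P {ω | M ω i j = 1} = c) {i j : Fin d} (hij : i ≠ j) :
    P {ω | M ω i j = 1} = c := by
  rcases lt_or_gt_of_ne hij with h | h
  · rw [← hlaw j i h]
    refine measure_congr ?_
    filter_upwards [hsymm] with ω hω
    exact congrArg (· = (1 : ℝ)) (hω.apply j i)
  · exact hlaw i j h

lemma IsSymmBernoulli.integral_entry {d : ℕ} {Ω : Type*} [MeasurableSpace Ω] {P : Measure Ω}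
    {ρ : ℝ} {B : Ω → Matrix (Fin d) (Fin d) ℝ} (hB : IsSymmBernoulli P ρ B) (hρ : 0 ≤ ρ)
    {i j : Fin d} (hij : i ≠ j) : ∫ ω, B ω i j ∂P = ρ := by
  have hs : MeasurableSet {ω | B ω i j = 1} := hB.measurable i j (measurableSet_singleton 1)
  have h : (fun ω => B ω i j) =ᵐ[P] {ω | B ω i j = 1}.indicator fun _ => (1 : ℝ) := by
    filter_upwards [hB.values] with ω hω
    rcases hω i j with h | h <;> simp [Set.indicator, h]
  rw [integral_congr_ae h, integral_indicator_const _ hs, measureReal_def,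
    measure_entry_eq_one hB.symm hB.law hij, ENNReal.toReal_ofReal hρ, smul_eq_mul, mul_one]

lemma IsSymmRademacher.integral_entry {d : ℕ} {Ω : Type*} [MeasurableSpace Ω] {P : Measure Ω}
    [IsProbabilityMeasure P] {E : Ω → Matrix (Fin d) (Fin d) ℝ} (hE : IsSymmRademacher P E)
    {i j : Fin d} (hij : i ≠ j) : ∫ ω, E ω i j ∂P = 0 := by
  have hs : MeasurableSet {ω | E ω i j = 1} := hE.measurable i j (measurableSet_singleton 1)
  have h : (fun ω => E ω i j) =ᵐ[P]
      fun ω => {ω | E ω i j = 1}.indicator (fun _ => (2 : ℝ)) ω - 1 := by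
    filter_upwards [hE.values] with ω hω
    rcases hω i j with h | h <;> norm_num [Set.indicator, h]
  rw [integral_congr_ae h, integral_sub ((integrable_const _).indicator hs) (integrable_const _),
    integral_indicator_const _ hs, measureReal_def, measure_entry_eq_one hE.symm hE.law hij]
  simp

lemma IsSymmBernoulli.integral_mul_entries {d : ℕ} {Ω : Type*} [MeasurableSpace Ω] {P : Measure Ω}
    {ρ : ℝ} {B : Ω → Matrix (Fin d) (Fin d) ℝ} (hB : IsSymmBernoulli P ρ B) (hρ : 0 ≤ ρ)
    {i j k l : Fin d} (hij : i ≠ j) (hkl : k ≠ l) (hne : s(i, j) ≠ s(k, l)) :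
    ∫ ω, B ω i j * B ω k l ∂P = ρ ^ 2 := by
  have h := integral_prod_entries hB.measurable hB.symm hB.indep ![i, k] ![j, l]
    (by simp [Fin.forall_fin_two, hij, hkl]) (by simpa [Fin.forall_fin_two, -Sym2.eq, -Sym2.rel_iff'] using ⟨hne, hne.symm⟩)
  simpa [Fin.prod_univ_two, hB.integral_entry hρ hij, hB.integral_entry hρ hkl, sq] using h

/-- A product of four Rademacher entries along a closed walk `j, i, l, k` with four distinct
edges is centered. -/
lemma IsSymmRademacher.integral_cycle {d : ℕ} {Ω : Type*} [MeasurableSpace Ω] {P : Measure Ω}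
    [IsProbabilityMeasure P] {E : Ω → Matrix (Fin d) (Fin d) ℝ} (hE : IsSymmRademacher P E)
    {i j k l : Fin d} (hik : i ≠ k) (hjl : j ≠ l) (hij : i ≠ j) (hkj : k ≠ j) (hil : i ≠ l)
    (hkl : k ≠ l) : ∫ ω, (E ω i j * E ω k j) * (E ω i l * E ω k l) ∂P = 0 := by
  have h := integral_prod_entries hE.measurable hE.symm hE.indep ![i, k, i, k] ![j, j, l, l]
    (by intro t; fin_cases t <;> simpa)
    (by
      intro s t
      fin_cases s <;> fin_cases t <;>
        simp [hik, hik.symm, hjl, hjl.symm, hij, hkj.symm, hil, hil.symm, hkl, hkj, hij.symm,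
          hkl.symm])
  simpa [Fin.prod_univ_four, hE.integral_entry hij, mul_assoc] using h

/-! ### The fourth moment -/

/-- Almost sure entrywise domination of `R ⊙ B ⊙ E` by the selectors `B`, including the vanishing
of the diagonal. -/
lemma ae_abs_entry_le {d : ℕ} {Ω : Type*} [MeasurableSpace Ω] {P : Measure Ω} {ρ : ℝ}
    {R B E : Ω → Matrix (Fin d) (Fin d) ℝ} (hR : IsBoundedCenteredSymm P R)
    (hB : IsSymmBernoulli P ρ B) (hE : IsSymmRademacher P E) :
    ∀ᵐ ω ∂P, ∀ i j, |((R ω ⊙ B ω) ⊙ E ω) i j| ≤ B ω i j ∧ 0 ≤ B ω i j ∧ B ω i j ≤ 1 ∧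
      ((R ω ⊙ B ω) ⊙ E ω) i i = 0 := by
  filter_upwards [hR.bounded, hR.diag_zero, hB.values, hE.values] with ω h1 h2 h3 h4 i j
  have hb := h1 i j
  rcases h3 i j with h | h <;> rcases h4 i j with h' | h' <;>
    simp [Matrix.hadamard_apply, h, h', h2 i, hb]

/-- The expectation of the monomial attached to the closed walk `i, j, k, l`: it vanishes when the
four edges are distinct, and otherwise is controlled by the probability that the one or two edges
of the walk are selected. -/
lemma integral_walk_le {d : ℕ} {ρ : ℝ} (hρ : 0 < ρ) {Ω : Type*} [MeasurableSpace Ω]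
    {P : Measure Ω} [IsProbabilityMeasure P] {R B E : Ω → Matrix (Fin d) (Fin d) ℝ}
    (hR : IsBoundedCenteredSymm P R) (hB : IsSymmBernoulli P ρ B) (hE : IsSymmRademacher P E)
    (hind : IndepFun (fun ω (i j : Fin d) => (R ω ⊙ B ω) i j) (fun ω (i j : Fin d) => E ω i j) P)
    {X : Ω → Matrix (Fin d) (Fin d) ℝ} (hX : X = fun ω => (R ω ⊙ B ω) ⊙ E ω) (i k j l : Fin d) :
    ∫ ω, (X ω i j * X ω k j) * (X ω i l * X ω k l) ∂P ≤
      (if i = k then if j = l then ρ else 0 else 0) + (if i = k then ρ ^ 2 else 0) +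
        (if j = l then ρ ^ 2 else 0) := by
  have hdom := ae_abs_entry_le hR hB hE
  have hnonneg : 0 ≤ (if i = k then if j = l then ρ else 0 else 0) +
      (if i = k then ρ ^ 2 else 0) + (if j = l then ρ ^ 2 else 0) := by positivity
  -- A walk with a loop contributes nothing, since the diagonal vanishes.
  by_cases hloop : i = j ∨ k = j ∨ i = l ∨ k = l
  · refine (integral_eq_zero_of_ae ?_).trans_le hnonneg
    filter_upwards [hdom] with ω hω
    have hz : ∀ a, X ω a a = 0 := fun a => by rw [hX]; exact (hω a a).2.2.2
    rcases hloop with rfl | rfl | rfl | rfl <;> simp [hz]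
  simp only [not_or] at hloop
  obtain ⟨hij, hkj, hil, hkl⟩ := hloop
  have hmX : ∀ i j, Measurable fun ω => X ω i j := fun i j => by
    rw [hX]; exact ((hR.measurable i j).mul (hB.measurable i j)).mul (hE.measurable i j)
  -- A product of two squared entries is at most the product of the two selectors.
  have hpair : ∀ a b a' b' : Fin d, ∫ ω, X ω a b ^ 2 * X ω a' b' ^ 2 ∂P ≤
      ∫ ω, B ω a b * B ω a' b' ∂P := by
    intro a b a' b'
    refine integral_mono_of_nonneg (.of_forall fun ω => by positivity) ?_ ?_
    · refine Integrable.of_bound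
        ((hB.measurable a b).mul (hB.measurable a' b')).aestronglyMeasurable 1 ?_
      filter_upwards [hdom] with ω hω
      have h1 := hω a b
      have h2 := hω a' b'
      rw [Real.norm_eq_abs, abs_of_nonneg (mul_nonneg h1.2.1 h2.2.1)]
      exact mul_le_one₀ h1.2.2.1 h2.2.1 h2.2.2.1
    · filter_upwards [hdom] with ω hω
      have hsq : ∀ a b, X ω a b ^ 2 ≤ B ω a b := fun a b => by
        obtain ⟨h1, h2, h3, -⟩ := hω a b
        rw [← sq_abs, hX]
        calc _ ≤ B ω a b ^ 2 := pow_le_pow_left₀ (abs_nonneg _) h1 2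
          _ ≤ B ω a b := by nlinarith
      exact mul_le_mul (hsq a b) (hsq a' b') (sq_nonneg _) (hω a b).2.1
  by_cases hik : i = k
  · subst hik
    have hrw : ∀ ω, X ω i j * X ω i j * (X ω i l * X ω i l) = X ω i j ^ 2 * X ω i l ^ 2 :=
      fun ω => by ring
    simp only [hrw]
    refine (hpair i j i l).trans ?_
    by_cases hjl : j = l
    · subst hjl
      have h : ∫ ω, B ω i j * B ω i j ∂P = ρ := by
        rw [← hB.integral_entry hρ.le hij]
        refine integral_congr_ae ?_
        filter_upwards [hB.values] with ω hω
        rcases hω i j with h | h <;> simp [h]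
      simp only [h, if_true]
      nlinarith [sq_nonneg ρ]
    · rw [hB.integral_mul_entries hρ.le hij hil (by simp [hjl, hil])]
      simp [hjl]
  · by_cases hjl : j = l
    · subst hjl
      have hrw : ∀ ω, X ω i j * X ω k j * (X ω i j * X ω k j) = X ω i j ^ 2 * X ω k j ^ 2 :=
        fun ω => by ring
      simp only [hrw]
      refine (hpair i j k j).trans ?_
      rw [hB.integral_mul_entries hρ.le hij hkj (by simp [hik, hij])]
      simp [hik]
    · refine le_of_eq_of_le ?_ hnonneg
      let f : (Fin d → Fin d → ℝ) → ℝ := fun a => (a i j * a k j) * (a i l * a k l)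
      have hf : Measurable f := by fun_prop
      have hmA : Measurable fun ω (i j : Fin d) => (R ω ⊙ B ω) i j :=
        measurable_pi_lambda _ fun i => measurable_pi_lambda _ fun j =>
          (hR.measurable i j).mul (hB.measurable i j)
      have hmE : Measurable fun ω (i j : Fin d) => E ω i j :=
        measurable_pi_lambda _ fun i => measurable_pi_lambda _ fun j => hE.measurable i j
      have h := hind.integral_fun_comp_mul_comp (f := f) (g := f) hmA.aemeasurable
        hmE.aemeasurable hf.aestronglyMeasurable hf.aestronglyMeasurable
      have hz : ∫ ω, f (fun i j => E ω i j) ∂P = 0 :=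
        hE.integral_cycle hik hjl hij hkj hil hkl
      rw [hz, mul_zero] at h
      rw [← h]
      refine integral_congr_ae (.of_forall fun ω => ?_)
      simp only [hX, f, Matrix.hadamard_apply]
      ring

/-- The fourth moment of the operator norm, together with the integrability of the norm and of its
fourth power. -/
lemma integral_schattenInfNorm_pow_four_le {d : ℕ} {ρ : ℝ} (hρ : 0 < ρ) {Ω : Type*}
    [MeasurableSpace Ω] {P : Measure Ω} [IsProbabilityMeasure P]
    {R B E : Ω → Matrix (Fin d) (Fin d) ℝ}
    (hR : IsBoundedCenteredSymm P R) (hB : IsSymmBernoulli P ρ B) (hE : IsSymmRademacher P E)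
    (hind : IndepFun (fun ω (i j : Fin d) => (R ω ⊙ B ω) i j)
      (fun ω (i j : Fin d) => E ω i j) P) :
    Integrable (fun ω => schattenInfNorm ((R ω ⊙ B ω) ⊙ E ω)) P ∧
    Integrable (fun ω => schattenInfNorm ((R ω ⊙ B ω) ⊙ E ω) ^ 4) P ∧
    ∫ ω, schattenInfNorm ((R ω ⊙ B ω) ⊙ E ω) ^ 4 ∂P ≤
      (d : ℝ) ^ 2 * ρ + 2 * ((d : ℝ) ^ 3 * ρ ^ 2) := by
  have hwalk := integral_walk_le hρ hR hB hE hind rfl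
  have hmX : ∀ i j, Measurable fun ω => ((R ω ⊙ B ω) ⊙ E ω) i j := fun i j =>
    ((hR.measurable i j).mul (hB.measurable i j)).mul (hE.measurable i j)
  have hbd : ∀ᵐ ω ∂P, ∀ i j, |((R ω ⊙ B ω) ⊙ E ω) i j| ≤ 1 := by
    filter_upwards [ae_abs_entry_le hR hB hE] with ω hω i j
    exact (hω i j).1.trans (hω i j).2.2.1
  generalize hX : (fun ω => (R ω ⊙ B ω) ⊙ E ω) = X at *
  have hXω : ∀ ω, (R ω ⊙ B ω) ⊙ E ω = X ω := fun ω => congrFun hX ω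
  simp only [hXω] at *
  have hmN := measurable_schattenInfNorm hmX
  have hN4 : ∀ᵐ ω ∂P, schattenInfNorm (X ω) ^ 4 ≤ (d : ℝ) ^ 4 := by
    filter_upwards [hbd] with ω hω
    refine (schattenInfNorm_pow_four_le (X ω)).trans ?_
    calc _ ≤ ∑ _i : Fin d, ∑ _k : Fin d, ∑ _j : Fin d, ∑ _l : Fin d, (1 : ℝ) := by
          refine Finset.sum_le_sum fun i _ => Finset.sum_le_sum fun k _ =>
            Finset.sum_le_sum fun j _ => Finset.sum_le_sum fun l _ => (le_abs_self _).trans ?_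
          simp only [abs_mul]
          exact mul_le_one₀ (mul_le_one₀ (hω _ _) (abs_nonneg _) (hω _ _)) (by positivity)
            (mul_le_one₀ (hω _ _) (abs_nonneg _) (hω _ _))
      _ = (d : ℝ) ^ 4 := by simp; ring
  have hint4 : Integrable (fun ω => schattenInfNorm (X ω) ^ 4) P := by
    refine Integrable.of_bound (hmN.pow_const 4).aestronglyMeasurable ((d : ℝ) ^ 4) ?_
    filter_upwards [hN4] with ω hω
    rwa [Real.norm_eq_abs, abs_of_nonneg (by positivity)]
  have hint1 : Integrable (fun ω => schattenInfNorm (X ω)) P := by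
    refine Integrable.of_bound hmN.aestronglyMeasurable (d : ℝ) ?_
    filter_upwards [hN4] with ω hω
    rw [Real.norm_eq_abs, abs_of_nonneg (schattenInfNorm_nonneg _)]
    exact le_of_pow_le_pow_left₀ (by norm_num) (Nat.cast_nonneg d) hω
  have hintw : ∀ i k j l, Integrable (fun ω => (X ω i j * X ω k j) * (X ω i l * X ω k l)) P := by
    intro i k j l
    refine Integrable.of_bound (((hmX i j).mul (hmX k j)).mul
      ((hmX i l).mul (hmX k l))).aestronglyMeasurable 1 ?_
    filter_upwards [hbd] with ω hω
    simp only [Real.norm_eq_abs, abs_mul]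
    exact mul_le_one₀ (mul_le_one₀ (hω _ _) (abs_nonneg _) (hω _ _)) (by positivity)
      (mul_le_one₀ (hω _ _) (abs_nonneg _) (hω _ _))
  refine ⟨hint1, hint4, ?_⟩
  calc ∫ ω, schattenInfNorm (X ω) ^ 4 ∂P
      ≤ ∫ ω, ∑ i, ∑ k, ∑ j, ∑ l, (X ω i j * X ω k j) * (X ω i l * X ω k l) ∂P :=
        integral_mono hint4
          (integrable_finsetSum _ fun i _ => integrable_finsetSum _ fun k _ =>
            integrable_finsetSum _ fun j _ => integrable_finsetSum _ fun l _ => hintw i k j l)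
          fun ω => schattenInfNorm_pow_four_le (X ω)
    _ = ∑ i, ∑ k, ∑ j, ∑ l, ∫ ω, (X ω i j * X ω k j) * (X ω i l * X ω k l) ∂P := by
        rw [integral_finsetSum _ fun i _ => integrable_finsetSum _ fun k _ =>
            integrable_finsetSum _ fun j _ => integrable_finsetSum _ fun l _ => hintw i k j l]
        refine Finset.sum_congr rfl fun i _ => ?_
        rw [integral_finsetSum _ fun k _ =>
            integrable_finsetSum _ fun j _ => integrable_finsetSum _ fun l _ => hintw i k j l]
        refine Finset.sum_congr rfl fun k _ => ?_
        rw [integral_finsetSum _ fun j _ => integrable_finsetSum _ fun l _ => hintw i k j l]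
        exact Finset.sum_congr rfl fun j _ => integral_finsetSum _ fun l _ => hintw i k j l
    _ ≤ ∑ i : Fin d, ∑ k : Fin d, ∑ j : Fin d, ∑ l : Fin d,
          ((if i = k then if j = l then ρ else 0 else 0) + (if i = k then ρ ^ 2 else 0) +
            (if j = l then ρ ^ 2 else 0)) :=
        Finset.sum_le_sum fun i _ => Finset.sum_le_sum fun k _ =>
          Finset.sum_le_sum fun j _ => Finset.sum_le_sum fun l _ => hwalk i k j l
    _ = (d : ℝ) ^ 2 * ρ + 2 * ((d : ℝ) ^ 3 * ρ ^ 2) := by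
        simp [Finset.sum_add_distrib, Finset.sum_ite_irrel]
        ring

/-! ### From the fourth moment to the mean -/

lemma integral_le_of_integral_pow_four_le {Ω : Type*} [MeasurableSpace Ω] {P : Measure Ω}
    [IsProbabilityMeasure P] {f : Ω → ℝ} (hf : Integrable f P)
    (hf4 : Integrable (fun ω => f ω ^ 4) P) {T : ℝ} (hT : 0 ≤ T)
    (h : ∫ ω, f ω ^ 4 ∂P ≤ T ^ 4) : ∫ ω, f ω ∂P ≤ T := by
  have hJ := (Even.convexOn_pow (𝕜 := ℝ) (n := 4) (by decide)).map_integral_le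
    (μ := P) (f := f) (continuous_pow 4).continuousOn isClosed_univ (by simp) hf hf4
  exact le_of_pow_le_pow_left₀ (by norm_num) hT (hJ.trans h)

lemma fourth_moment_bound_le_pow_four {x ρ : ℝ} (hx : 0 ≤ x) (hρ : 0 ≤ ρ) :
    x ^ 2 * ρ + 2 * (x ^ 3 * ρ ^ 2) ≤
      (1 * x ^ (1 / 2 : ℝ) * ρ ^ (1 / 4 : ℝ) + 2 * x ^ (3 / 4 : ℝ) * ρ ^ (1 / 2 : ℝ)) ^ 4 := by
  have key : ∀ {y : ℝ}, 0 ≤ y → ∀ (s : ℝ) (n : ℕ), s * 4 = n → (y ^ s) ^ 4 = y ^ n := by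
    intro y hy s n hs
    rw [← Real.rpow_natCast (y ^ s), ← Real.rpow_mul hy, ← Real.rpow_natCast y n, ← hs]
    norm_num
  have h1 := key hx (1 / 2) 2 (by norm_num)
  have h2 := key hρ (1 / 4) 1 (by norm_num)
  have h3 := key hx (3 / 4) 3 (by norm_num)
  have h4 := key hρ (1 / 2) 2 (by norm_num)
  calc x ^ 2 * ρ + 2 * (x ^ 3 * ρ ^ 2) ≤ x ^ 2 * ρ + 16 * (x ^ 3 * ρ ^ 2) := by
        have : 0 ≤ x ^ 3 * ρ ^ 2 := by positivity
        linarith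
    _ = (1 * x ^ (1 / 2 : ℝ) * ρ ^ (1 / 4 : ℝ)) ^ 4 +
          (2 * x ^ (3 / 4 : ℝ) * ρ ^ (1 / 2 : ℝ)) ^ 4 := by
        simp only [mul_pow, h1, h2, h3, h4]
        ring
    _ ≤ _ := pow_add_pow_le (by positivity) (by positivity) (by norm_num)

theorem lemma2 :
    ∃ K₁ K₂ : ℝ, 0 < K₁ ∧ 0 < K₂ ∧
      ∀ (d : ℕ) (ρ : ℝ), 0 < ρ → ρ < 1 →
      ∀ (Ω : Type*) [MeasurableSpace Ω] (P : Measure Ω) [IsProbabilityMeasure P]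
        (R B E : Ω → Matrix (Fin d) (Fin d) ℝ),
        IsBoundedCenteredSymm P R →
        IsSymmBernoulli P ρ B →
        IsSymmRademacher P E →
        IndepFun (fun ω (i j : Fin d) => (R ω ⊙ B ω) i j) (fun ω (i j : Fin d) => E ω i j) P →
        Integrable (fun ω => schattenInfNorm ((R ω ⊙ B ω) ⊙ E ω)) P ∧
        ∫ ω, schattenInfNorm ((R ω ⊙ B ω) ⊙ E ω) ∂P ≤
          K₁ * (d : ℝ) ^ (1 / 2 : ℝ) * ρ ^ (1 / 4 : ℝ) +
            K₂ * (d : ℝ) ^ (3 / 4 : ℝ) * ρ ^ (1 / 2 : ℝ) := by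
  refine ⟨1, 2, one_pos, two_pos, fun d ρ hρ _ Ω _ P _ R B E hR hB hE hind => ?_⟩
  obtain ⟨h1, h4, h⟩ := integral_schattenInfNorm_pow_four_le hρ hR hB hE hind
  exact ⟨h1, integral_le_of_integral_pow_four_le h1 h4 (by positivity)
    (h.trans (fourth_moment_bound_le_pow_four (Nat.cast_nonneg d) hρ.le))⟩
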